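/- Let $\alpha\in(0,1)$, $a\in\mathbb C\setminus\{0\}$, and let $\omega_n=\binom{n-\alpha}{n}^{-1}$ for $n\in\mathbb N=\{0,1,2,\dots\}$, where $\binom{x}{n}=x(x-1)\cdots(x-n+1)/n!$. Let $H^2_\omega$ be the Hilbert space of holomorphic functions $f(z)=\sum_{n\ge0}f_nz^n$ on the open unit disc with $\|f\|_\omega^2=\sum_{n\ge 0}|f_n|^2\omega_n<\infty$ and inner product $\langle f,g\rangle=\sum_{n\ge0}f_n\overline{g_n}\,\omega_n$. Let $M_{a-z}$ be the bounded operator on $H^2_\omega$ given by $(M_{a-z}f)(z)=(a-z)f(z)$, let $V_a=M_{a-z}^*M_{a-z}$, and let $\sigma_{\mathrm p}(V_a)$ be its set of eigenvalues. For $j\in\mathbb N$ put $$\varrho_j=\sqrt{\alpha^2+4|a|^2(j+1)(j+1-\alpha)},\qquad \lambda_j^{\pm}=|a|^2+1+\frac{\alpha^2\pm(2j+2-\alpha)\varrho_j}{2(j+1)(j+1-\alpha)},\qquad \tau_j^{\pm}=\pm\frac{\varrho_j\mp\alpha}{2(j+1)},$$ and $$h_j^{\pm}(z)=\frac{\bigl(z+\tau_j^{\pm}/\overline{a}\bigr)^j}{\bigl(1+(\tau_j^{\pm}/a)\,z\bigr)^{j+2-\alpha}},$$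 with the principal branch of the power in the denominator. Then: (i) If $0<|a|\le1$, then $\sigma_{\mathrm p}(V_a)=\{\lambda_j^+: j\in\mathbb N\}$, and for every $j\in\mathbb N$ the function $h_j^+$ belongs to $H^2_\omega$ and the eigenspace $\ker(V_a-\lambda_j^+I)$ is one-dimensional and equal to $\mathrm{span}\{h_j^+\}$. (ii) If $|a|>1$, then $\sigma_{\mathrm p}(V_a)=\{\lambda_j^+: j\in\mathbb N\}\cup\{\lambda_j^-: j\in\mathbb N\}$, and for every $j\in\mathbb N$ and each choice of sign the function $h_j^{\pm}$ belongs to $H^2_\omega$ and the eigenspace $\ker(V_a-\lambda_j^{\pm}I)$ is one-dimensional and equal to $\mathrm{span}\{h_j^{\pm}\}$. -/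

import Mathlib

noncomputable section

namespace WeightedHardy

/-! ### Holomorphic functions on the open unit disc -/

/-- The open unit disc of the complex plane. -/
abbrev Disc : Set ℂ := Metric.ball (0 : ℂ) 1

/-- Extension by zero of a function on the disc to the whole plane. Only the values in the (open)
disc matter in what follows. -/
def ext (f : Disc → ℂ) : ℂ → ℂ := Function.extend Subtype.val f 0

theorem ext_apply (f : Disc → ℂ) (z : Disc) : ext f z = f z :=
  Subtype.val_injective.extend_apply f 0 z

/-- `f` is holomorphic on the unit disc. -/
def IsHolomorphic (f : Disc → ℂ) : Prop := DifferentiableOn ℂ (ext f) Disc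

/-- The `n`-th Maclaurin coefficient of `f`. -/
def coeff (f : Disc → ℂ) (n : ℕ) : ℂ := iteratedDeriv n (ext f) 0 / (Nat.factorial n : ℂ)

theorem IsHolomorphic.hasSum {f : Disc → ℂ} (hf : IsHolomorphic f) (z : Disc) :
    HasSum (fun n => coeff f n * (z : ℂ) ^ n) (f z) := by
  have h := Complex.hasSum_taylorSeries_on_ball hf z.2
  rw [ext_apply] at h
  convert! h using 1
  funext n
  simp only [coeff, sub_zero, smul_eq_mul]
  ring

theorem holomorphic_of_hasSum {f : Disc → ℂ} {c : ℕ → ℂ}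
    (h : ∀ z : Disc, HasSum (fun n => c n * (z : ℂ) ^ n) (f z)) :
    IsHolomorphic f ∧ coeff f = c := by
  have hp : HasFPowerSeriesOnBall (ext f) (FormalMultilinearSeries.ofScalars ℂ c) 0 1 := by
    refine ⟨?_, one_pos, ?_⟩
    · refine ENNReal.le_of_forall_nnreal_lt fun r hr => ?_
      have hr1 : (r : ℝ) < 1 := by exact_mod_cast hr
      have hz : ((r : ℝ) : ℂ) ∈ Disc := by
        simp [Disc, hr1]
      have h1 := (h ⟨_, hz⟩).summable.norm
      refine FormalMultilinearSeries.le_radius_of_summable _ ?_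
      refine h1.congr fun n => ?_
      rw [FormalMultilinearSeries.ofScalars_norm]
      simp
    · intro y hy
      have hy' : y ∈ Disc := by
        have h1 : edist y 0 < 1 := by simpa using hy
        rw [edist_dist] at h1
        have h2 : dist y 0 < 1 := by
          by_contra hcon
          push Not at hcon
          exact absurd h1 (not_lt.mpr (by simpa using ENNReal.ofReal_le_ofReal hcon))
        simpa [Disc] using h2
      have h1 := h ⟨y, hy'⟩
      rw [zero_add, show ext f y = f ⟨y, hy'⟩ from ext_apply f ⟨y, hy'⟩]
      simpa [FormalMultilinearSeries.ofScalars_apply_eq, smul_eq_mul, mul_comm] using h1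
  refine ⟨?_, ?_⟩
  · have h1 := hp.differentiableOn
    have h2 : Metric.eball (0 : ℂ) 1 = Disc := by
      have := Metric.eball_ofReal (x := (0 : ℂ)) (ε := 1)
      simpa using this
    rw [h2] at h1
    exact h1
  · have h1 := hp.analyticAt.hasFPowerSeriesAt
    have h2 := h1.eq_formalMultilinearSeries hp.hasFPowerSeriesAt
    exact FormalMultilinearSeries.ofScalars_series_injective ℂ ℂ h2

theorem eq_of_coeff_eq {f g : Disc → ℂ} (hf : IsHolomorphic f) (hg : IsHolomorphic g)
    (h : coeff f = coeff g) : f = g := by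
  funext z
  refine (hf.hasSum z).unique ?_
  rw [h]
  exact hg.hasSum z

/-! ### Weights and weighted Hardy spaces -/

/-- A valid weight: a monotonic positive sequence `ω` with `ω 0 = 1`, `ω (n+1) / ω n → 1` and
`∑ (1 - ω (n+1) / ω n)² < ∞`. -/
structure ValidWeight where
  toFun : ℕ → ℝ
  pos : ∀ n, 0 < toFun n
  monotonic : Monotone toFun ∨ Antitone toFun
  zero : toFun 0 = 1
  tendsto_ratio : Filter.Tendsto (fun n => toFun (n + 1) / toFun n) Filter.atTop (nhds 1)
  summable_sq : Summable fun n => (1 - toFun (n + 1) / toFun n) ^ 2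

instance : CoeFun ValidWeight (fun _ => ℕ → ℝ) := ⟨ValidWeight.toFun⟩

/-- Membership in `H²_ω`: `f` is holomorphic in the disc and `∑ |f_n|² ω_n < ∞`. -/
def MemH2 (ω : ValidWeight) (f : Disc → ℂ) : Prop :=
  IsHolomorphic f ∧ Summable fun n => ‖coeff f n‖ ^ 2 * ω n

theorem coeff_add {f g : Disc → ℂ} (hf : IsHolomorphic f) (hg : IsHolomorphic g) :
    IsHolomorphic (f + g) ∧ coeff (f + g) = coeff f + coeff g :=
  holomorphic_of_hasSum fun z => by
    simpa [add_mul] using (hf.hasSum z).add (hg.hasSum z)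

theorem coeff_smul {f : Disc → ℂ} (c : ℂ) (hf : IsHolomorphic f) :
    IsHolomorphic (c • f) ∧ coeff (c • f) = c • coeff f :=
  holomorphic_of_hasSum fun z => by
    simpa [mul_assoc] using (hf.hasSum z).mul_left c

theorem coeff_zero : IsHolomorphic 0 ∧ coeff 0 = 0 :=
  holomorphic_of_hasSum fun z => by
    simp [hasSum_zero]

theorem summable_sq_add (ω : ValidWeight) {c d : ℕ → ℂ}
    (hc : Summable fun n => ‖c n‖ ^ 2 * ω n) (hd : Summable fun n => ‖d n‖ ^ 2 * ω n) :
    Summable fun n => ‖(c + d) n‖ ^ 2 * ω n := by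
  refine Summable.of_nonneg_of_le (fun n => mul_nonneg (sq_nonneg _) (ω.pos n).le) (fun n => ?_)
    ((hc.add hd).mul_left 2)
  have h1 : ‖c n + d n‖ ^ 2 ≤ 2 * (‖c n‖ ^ 2 + ‖d n‖ ^ 2) := by
    have h2 := norm_add_le (c n) (d n)
    nlinarith [sq_nonneg (‖c n‖ - ‖d n‖), norm_nonneg (c n + d n)]
  have h3 := mul_le_mul_of_nonneg_right h1 (ω.pos n).le
  simp only [Pi.add_apply]
  linarith

/-- `H²_ω` as a linear subspace of the functions on the disc. -/
def h2Submodule (ω : ValidWeight) : Submodule ℂ (Disc → ℂ) where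
  carrier := {f | MemH2 ω f}
  add_mem' := fun {f g} hf hg => by
    obtain ⟨h1, h2⟩ := coeff_add hf.1 hg.1
    refine ⟨h1, ?_⟩
    rw [h2]
    exact summable_sq_add ω hf.2 hg.2
  zero_mem' := by
    obtain ⟨h1, h2⟩ := coeff_zero
    refine ⟨h1, ?_⟩
    rw [h2]
    simp [summable_zero]
  smul_mem' := fun c f hf => by
    obtain ⟨h1, h2⟩ := coeff_smul c hf.1
    refine ⟨h1, ?_⟩
    rw [h2]
    refine (hf.2.mul_left (‖c‖ ^ 2)).congr fun n => ?_
    simp [mul_pow, mul_assoc]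

/-- The weighted Hardy space `H²_ω`. It is a type synonym of the subspace above, so that it does
not inherit the topology of pointwise convergence. -/
def H2 (ω : ValidWeight) : Type := h2Submodule ω

instance (ω : ValidWeight) : AddCommGroup (H2 ω) := inferInstanceAs (AddCommGroup (h2Submodule ω))

instance (ω : ValidWeight) : Module ℂ (H2 ω) := inferInstanceAs (Module ℂ (h2Submodule ω))

namespace H2

variable {ω : ValidWeight}

/-- The function on the disc underlying an element of `H²_ω`. -/
def fn (f : H2 ω) : Disc → ℂ := f.1

instance : CoeFun (H2 ω) (fun _ => Disc → ℂ) := ⟨fn⟩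

theorem ext' {f g : H2 ω} (h : ∀ z, f z = g z) : f = g := Subtype.ext (funext h)

theorem holo (f : H2 ω) : IsHolomorphic f := f.2.1

theorem summable (f : H2 ω) : Summable fun n => ‖coeff f n‖ ^ 2 * ω n := f.2.2

theorem coeff_add (f g : H2 ω) (n : ℕ) : coeff (f + g).fn n = coeff f n + coeff g n :=
  congrFun (WeightedHardy.coeff_add f.holo g.holo).2 n

theorem coeff_smul (c : ℂ) (f : H2 ω) (n : ℕ) : coeff (c • f).fn n = c * coeff f n :=
  congrFun (WeightedHardy.coeff_smul c f.holo).2 n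

theorem eq_of_coeff {f g : H2 ω} (h : ∀ n, coeff f n = coeff g n) : f = g :=
  Subtype.ext (eq_of_coeff_eq f.holo g.holo (funext h))

theorem summable_inner (f g : H2 ω) :
    Summable fun n => (starRingEnd ℂ) (coeff f n) * coeff g n * (ω n : ℂ) := by
  refine Summable.of_norm_bounded (f.summable.add g.summable) fun n => ?_
  rw [norm_mul, norm_mul, RCLike.norm_conj, Complex.norm_real, Real.norm_eq_abs,
    abs_of_pos (ω.pos n), ← add_mul]
  refine mul_le_mul_of_nonneg_right ?_ (ω.pos n).le
  nlinarith [sq_nonneg (‖coeff f n‖ - ‖coeff g n‖), sq_nonneg (‖coeff f n‖),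
    sq_nonneg (‖coeff g n‖)]

theorem inner_self_term (f : H2 ω) (n : ℕ) :
    (starRingEnd ℂ) (coeff f n) * coeff f n * (ω n : ℂ) = ((‖coeff f n‖ ^ 2 * ω n : ℝ) : ℂ) := by
  rw [Complex.conj_mul']
  push_cast
  rfl

/-- The inner product of `H²_ω`, `∑ conj(f_n) g_n ω_n` (conjugate-linear in the first entry,
as everywhere in Mathlib). -/
@[reducible] def core (ω : ValidWeight) : InnerProductSpace.Core ℂ (H2 ω) where
  inner f g := ∑' n, (starRingEnd ℂ) (coeff f n) * coeff g n * (ω n : ℂ)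
  conj_inner_symm f g := by
    rw [Complex.conj_tsum]
    refine tsum_congr fun n => ?_
    simp only [map_mul, Complex.conj_conj, Complex.conj_ofReal]
    ring
  re_inner_nonneg f := by
    simp only [inner_self_term]
    rw [← Complex.ofReal_tsum]
    exact tsum_nonneg fun n => mul_nonneg (sq_nonneg _) (ω.pos n).le
  add_left f g h := by
    rw [← (summable_inner f h).tsum_add (summable_inner g h)]
    refine tsum_congr fun n => ?_
    rw [coeff_add, map_add]
    ring
  smul_left f g c := by
    rw [← tsum_mul_left]
    refine tsum_congr fun n => ?_
    rw [coeff_smul, map_mul]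
    ring
  definite f hf := by
    simp only [inner_self_term] at hf
    rw [← Complex.ofReal_tsum] at hf
    have h0 : ∑' n, ‖coeff f n‖ ^ 2 * ω n = 0 := by exact_mod_cast hf
    have h1 := (hasSum_zero_iff_of_nonneg
      (fun n => mul_nonneg (sq_nonneg (‖coeff f n‖)) (ω.pos n).le)).1 (h0 ▸ f.summable.hasSum)
    refine eq_of_coeff fun n => ?_
    have h2 : ‖coeff f n‖ ^ 2 * ω n = 0 := congrFun h1 n
    have h3 : coeff f n = 0 := by
      simpa [(ω.pos n).ne'] using h2
    rw [h3]
    exact (congrFun WeightedHardy.coeff_zero.2 n).symm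

instance : NormedAddCommGroup (H2 ω) := (core ω).toNormedAddCommGroup

instance : InnerProductSpace ℂ (H2 ω) := InnerProductSpace.ofCore (core ω).toCore

theorem inner_def (f g : H2 ω) :
    inner ℂ f g = ∑' n, (starRingEnd ℂ) (coeff f n) * coeff g n * (ω n : ℂ) := rfl

theorem norm_sq (f : H2 ω) : ‖f‖ ^ 2 = ∑' n, ‖coeff f n‖ ^ 2 * ω n := by
  have h := inner_self_eq_norm_sq (𝕜 := ℂ) f
  rw [← h, inner_def]
  simp only [inner_self_term]
  rw [← Complex.ofReal_tsum]
  rfl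

/-! ### Completeness -/

/-- Every square-summable sequence (with respect to `ω`) is the sequence of Maclaurin coefficients
of an element of `H²_ω`. -/
theorem exists_of_summable {c : ℕ → ℂ} (hc : Summable fun n => ‖c n‖ ^ 2 * ω n) :
    ∃ f : H2 ω, ∀ n, coeff f n = c n := by
  have hs : ∀ z : Disc, Summable fun n => c n * (z : ℂ) ^ n := by
    intro z
    have hz : ‖(z : ℂ)‖ < 1 := mem_ball_zero_iff.1 z.2
    obtain ⟨r, hr, hr1⟩ := exists_between hz
    have hr0 : 0 < r := (norm_nonneg _).trans_lt hr
    have hw : Summable fun n => (ω n)⁻¹ * (r ^ 2) ^ n := by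
      refine summable_of_ratio_test_tendsto_lt_one (l := r ^ 2) (by nlinarith)
        (Filter.Eventually.of_forall fun n =>
          (mul_pos (inv_pos.2 (ω.pos n)) (pow_pos (pow_pos hr0 2) n)).ne') ?_
      have h1 := (ω.tendsto_ratio.inv₀ one_ne_zero).mul_const (r ^ 2)
      rw [inv_one, one_mul] at h1
      refine h1.congr fun n => ?_
      have h2 := ω.pos n
      have h3 := ω.pos (n + 1)
      rw [Real.norm_of_nonneg (by positivity), Real.norm_of_nonneg (by positivity)]
      field_simp
      ring
    refine Summable.of_norm_bounded (hc.add hw) fun n => ?_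
    have h2 := ω.pos n
    have h3 : ‖c n * (z : ℂ) ^ n‖ ≤ ‖c n‖ * r ^ n := by
      rw [norm_mul, norm_pow]
      gcongr
    refine h3.trans ?_
    have h4 : ‖c n‖ ^ 2 * ω n + (ω n)⁻¹ * (r ^ 2) ^ n - 2 * (‖c n‖ * r ^ n)
        = (ω n)⁻¹ * (‖c n‖ * ω n - r ^ n) ^ 2 := by
      field_simp
      ring
    have h5 : 0 ≤ (ω n)⁻¹ * (‖c n‖ * ω n - r ^ n) ^ 2 := by positivity
    have h6 : 0 ≤ ‖c n‖ * r ^ n := by positivity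
    linarith
  obtain ⟨h1, h2⟩ := holomorphic_of_hasSum (f := fun z : Disc => ∑' n, c n * (z : ℂ) ^ n)
    fun z => (hs z).hasSum
  refine ⟨⟨_, h1, ?_⟩, fun n => congrFun h2 n⟩
  rw [h2]
  exact hc

theorem memℓp_coeff (f : H2 ω) :
    Memℓp (fun n => coeff f n * (Real.sqrt (ω n) : ℂ)) 2 := by
  rw [memℓp_gen_iff (by norm_num)]
  refine f.summable.congr fun n => ?_
  have h := Real.sq_sqrt (ω.pos n).le
  simp only [ENNReal.toReal_ofNat, Real.rpow_ofNat, norm_mul, Complex.norm_real, mul_pow,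
    Real.norm_eq_abs, sq_abs, h]

/-- The coefficient isometry `f ↦ (f_n √ω_n)` from `H²_ω` to `ℓ²`. -/
def toL2 (ω : ValidWeight) : H2 ω →ₗᵢ[ℂ] lp (fun _ : ℕ => ℂ) 2 where
  toFun f := ⟨fun n => coeff f n * (Real.sqrt (ω n) : ℂ), memℓp_coeff f⟩
  map_add' f g := by
    ext n
    change coeff (f + g).fn n * _ = coeff f n * _ + coeff g n * _
    rw [coeff_add, add_mul]
  map_smul' c f := by
    ext n
    change coeff (c • f).fn n * _ = c * (coeff f n * _)
    rw [coeff_smul, mul_assoc]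
  norm_map' f := by
    rw [← sq_eq_sq₀ (norm_nonneg _) (norm_nonneg _), norm_sq]
    have h := lp.norm_rpow_eq_tsum (p := 2) (by norm_num)
      (⟨fun n => coeff f n * (Real.sqrt (ω n) : ℂ), memℓp_coeff f⟩ : lp (fun _ : ℕ => ℂ) 2)
    simp only [ENNReal.toReal_ofNat, Real.rpow_ofNat] at h
    refine h.trans (tsum_congr fun n => ?_)
    have h := Real.sq_sqrt (ω.pos n).le
    simp only [norm_mul, Complex.norm_real, mul_pow, Real.norm_eq_abs, sq_abs, h]

theorem toL2_surjective : Function.Surjective (toL2 ω) := by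
  intro x
  have hx := (memℓp_gen_iff (p := 2) (by norm_num)).1 (lp.memℓp x)
  have hpos : ∀ n, Real.sqrt (ω n) ≠ 0 := fun n => (Real.sqrt_pos.2 (ω.pos n)).ne'
  obtain ⟨f, hf⟩ := exists_of_summable (ω := ω) (c := fun n => x n / (Real.sqrt (ω n) : ℂ)) (by
    refine hx.congr fun n => ?_
    have h := Real.sq_sqrt (ω.pos n).le
    simp only [ENNReal.toReal_ofNat, Real.rpow_ofNat, norm_div, Complex.norm_real, div_pow,
      Real.norm_eq_abs, sq_abs, h]
    rw [div_mul_cancel₀ _ (ω.pos n).ne'])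
  refine ⟨f, ?_⟩
  ext n
  change coeff f n * (Real.sqrt (ω n) : ℂ) = x n
  rw [hf n, div_mul_cancel₀ _ (by exact_mod_cast hpos n)]

instance : CompleteSpace (H2 ω) :=
  ((LinearIsometryEquiv.ofSurjective (toL2 ω) toL2_surjective).isometry.isUniformInducing.completeSpace
    (by
      rw [Set.range_eq_univ.2 (LinearIsometryEquiv.surjective _)]
      exact isClosed_univ.isComplete))

end H2

/-! ### Multiplication by `a - z` and the operator `V_a` -/

theorem coeff_mul_z {f : Disc → ℂ} (hf : IsHolomorphic f) :
    IsHolomorphic (fun z : Disc => (z : ℂ) * f z) ∧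
      coeff (fun z : Disc => (z : ℂ) * f z) = fun n => Nat.casesOn n 0 (coeff f) := by
  refine holomorphic_of_hasSum fun z => ?_
  rw [← hasSum_nat_add_iff' 1]
  have h := (hf.hasSum z).mul_left (z : ℂ)
  convert! h using 1
  · funext n
    simp only [pow_succ]
    ring
  · simp

theorem ratio_bdd (ω : ValidWeight) : ∃ C : ℝ, 0 ≤ C ∧ ∀ n, ω (n + 1) ≤ C * ω n := by
  obtain ⟨C, hC⟩ := ω.tendsto_ratio.bddAbove_range
  refine ⟨max C 0, le_max_right _ _, fun n => ?_⟩
  rw [← div_le_iff₀ (ω.pos n)]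
  exact (hC ⟨n, rfl⟩).trans (le_max_left _ _)

/-- Square-summability, with a bound, of the coefficients of `z f(z)`. -/
theorem summable_shift (ω : ValidWeight) : ∃ C : ℝ, 0 ≤ C ∧ ∀ f : H2 ω,
    (Summable fun n => ‖coeff (fun z : Disc => (z : ℂ) * f z) n‖ ^ 2 * ω n) ∧
    ∑' n, ‖coeff (fun z : Disc => (z : ℂ) * f z) n‖ ^ 2 * ω n ≤ C * ‖f‖ ^ 2 := by
  obtain ⟨C, hC, h⟩ := ratio_bdd ω
  refine ⟨C, hC, fun f => ?_⟩
  rw [(coeff_mul_z f.holo).2]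
  have hle : ∀ n, ‖coeff f n‖ ^ 2 * ω (n + 1) ≤ C * (‖coeff f n‖ ^ 2 * ω n) := fun n => by
    have := mul_le_mul_of_nonneg_left (h n) (sq_nonneg ‖coeff f n‖)
    linarith
  have hs : Summable fun n => ‖coeff f n‖ ^ 2 * ω (n + 1) :=
    Summable.of_nonneg_of_le (fun n => mul_nonneg (sq_nonneg _) (ω.pos _).le) hle
      (f.summable.mul_left C)
  have hs' : Summable fun n : ℕ => ‖(Nat.casesOn n 0 (coeff f) : ℂ)‖ ^ 2 * ω n :=
    (summable_nat_add_iff 1).1 hs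
  refine ⟨hs', ?_⟩
  rw [hs'.tsum_eq_zero_add, H2.norm_sq, ← tsum_mul_left]
  simpa using hs.tsum_le_tsum hle (f.summable.mul_left C)

theorem mul_z_mem {ω : ValidWeight} (f : H2 ω) : MemH2 ω (fun z : Disc => (z : ℂ) * f z) :=
  ⟨(coeff_mul_z f.holo).1, ((summable_shift ω).choose_spec.2 f).1⟩

theorem mul_sub_mem {ω : ValidWeight} (a : ℂ) (f : H2 ω) :
    MemH2 ω (fun z : Disc => (a - z) * f z) := by
  have h := (h2Submodule ω).sub_mem ((h2Submodule ω).smul_mem a f.2) (mul_z_mem f)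
  convert! h using 1
  funext z
  exact sub_mul a (z : ℂ) (f z)

/-- Multiplication by the polynomial `a - z` as a linear map of `H²_ω`. -/
def mulLin (ω : ValidWeight) (a : ℂ) : H2 ω →ₗ[ℂ] H2 ω where
  toFun f := ⟨fun z => (a - z) * f z, mul_sub_mem a f⟩
  map_add' f g := H2.ext' fun z => mul_add (a - z) (f z) (g z)
  map_smul' c f := H2.ext' fun z => mul_left_comm (a - z) c (f z)

theorem mulLin_bound (ω : ValidWeight) (a : ℂ) : ∃ C : ℝ, ∀ f : H2 ω, ‖mulLin ω a f‖ ≤ C * ‖f‖ := by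
  obtain ⟨C, hC, h⟩ := summable_shift ω
  refine ⟨‖a‖ + Real.sqrt C, fun f => ?_⟩
  let g : H2 ω := ⟨fun z => (z : ℂ) * f z, mul_z_mem f⟩
  have h1 : mulLin ω a f = a • f - g := H2.ext' fun z => sub_mul a (z : ℂ) (f z)
  have h2 : ‖g‖ ≤ Real.sqrt C * ‖f‖ := by
    rw [← Real.sqrt_sq (norm_nonneg f), ← Real.sqrt_mul hC]
    refine Real.le_sqrt_of_sq_le ?_
    rw [H2.norm_sq]
    exact (h f).2
  rw [h1, add_mul]
  exact (norm_sub_le _ _).trans (add_le_add (norm_smul_le a f) h2)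

/-- The bounded multiplication operator `M_{a-z} f (z) = (a - z) f(z)` on `H²_ω`. -/
def M (ω : ValidWeight) (a : ℂ) : H2 ω →L[ℂ] H2 ω :=
  (mulLin ω a).mkContinuousOfExistsBound (mulLin_bound ω a)

theorem M_apply (ω : ValidWeight) (a : ℂ) (f : H2 ω) (z : Disc) : M ω a f z = (a - z) * f z := rfl

/-- `V_a = M_{a-z}^* M_{a-z}`, with the Hilbert space adjoint in `H²_ω`. -/
def V (ω : ValidWeight) (a : ℂ) : H2 ω →L[ℂ] H2 ω :=
  (ContinuousLinearMap.adjoint (M ω a)).comp (M ω a)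

/-- The point spectrum: the set of eigenvalues. -/
def pointSpectrum {ω : ValidWeight} (T : H2 ω →L[ℂ] H2 ω) : Set ℂ :=
  {l | Module.End.HasEigenvalue (T : H2 ω →ₗ[ℂ] H2 ω) l}

/-- The eigenspace `ker (T - l I)`. -/
def eigenspace {ω : ValidWeight} (T : H2 ω →L[ℂ] H2 ω) (l : ℂ) : Submodule ℂ (H2 ω) :=
  Module.End.eigenspace (T : H2 ω →ₗ[ℂ] H2 ω) l

/-! ### The weights `binom(n - α, n)⁻¹` -/

theorem choose_pos {α : ℝ} (hα : α < 1) (n : ℕ) : 0 < Ring.choose ((n : ℝ) - α) n := by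
  have h := Ring.multichoose_eq (1 - α) n
  rw [show (1 - α) + (n : ℝ) - 1 = n - α by ring] at h
  rw [← h]
  have h1 := Ring.factorial_nsmul_multichoose_eq_ascPochhammer (1 - α) n
  rw [Polynomial.ascPochhammer_smeval_eq_eval, nsmul_eq_mul] at h1
  have h2 : 0 < (ascPochhammer ℝ n).eval (1 - α) := ascPochhammer_pos n _ (by linarith)
  rw [← h1] at h2
  exact pos_of_mul_pos_right h2 (by positivity)

theorem choose_succ (α : ℝ) (n : ℕ) :
    ((n : ℝ) + 1) * Ring.choose (((n + 1 : ℕ) : ℝ) - α) (n + 1)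
      = ((n : ℝ) + 1 - α) * Ring.choose ((n : ℝ) - α) n := by
  have h := Ring.multichoose_eq (1 - α) n
  rw [show (1 - α) + (n : ℝ) - 1 = n - α by ring] at h
  have h' := Ring.multichoose_eq (1 - α) (n + 1)
  rw [show (1 - α) + ((n + 1 : ℕ) : ℝ) - 1 = (n + 1 : ℕ) - α by ring] at h'
  rw [← h, ← h']
  have h1 := Ring.factorial_nsmul_multichoose_eq_ascPochhammer (1 - α) n
  have h2 := Ring.factorial_nsmul_multichoose_eq_ascPochhammer (1 - α) (n + 1)
  rw [Polynomial.ascPochhammer_smeval_eq_eval, nsmul_eq_mul] at h1 h2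
  rw [ascPochhammer_succ_eval, ← h1, Nat.factorial_succ] at h2
  push_cast at h2
  have hf : (n.factorial : ℝ) ≠ 0 := by positivity
  apply mul_left_cancel₀ hf
  linear_combination h2

theorem weight_ratio {α : ℝ} (hα : α < 1) (n : ℕ) :
    (Ring.choose (((n + 1 : ℕ) : ℝ) - α) (n + 1))⁻¹ / (Ring.choose ((n : ℝ) - α) n)⁻¹
      = ((n : ℝ) + 1) / ((n : ℝ) + 1 - α) := by
  have h0 := choose_pos hα n
  have h1 := choose_pos hα (n + 1)
  have h2 := choose_succ α n
  have h3 : (0 : ℝ) < (n : ℝ) + 1 - α := by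
    have : (0 : ℝ) ≤ n := n.cast_nonneg
    linarith
  rw [div_inv_eq_mul, inv_mul_eq_div, div_eq_div_iff h1.ne' h3.ne']
  linarith

/-- The weight `ω_n = binom(n - α, n)⁻¹`, for `α < 1`, where
`binom(x, n) = x (x - 1) ⋯ (x - n + 1) / n!` is the generalized binomial coefficient. -/
def binomWeight (α : ℝ) (hα : α < 1) : ValidWeight where
  toFun n := (Ring.choose ((n : ℝ) - α) n)⁻¹
  pos n := inv_pos.2 (choose_pos hα n)
  monotonic := by
    have hpos : ∀ n : ℕ, (0 : ℝ) < (n : ℝ) + 1 - α := fun n => by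
      have : (0 : ℝ) ≤ n := n.cast_nonneg
      linarith
    rcases le_total 0 α with h | h
    · refine Or.inl (monotone_nat_of_le_succ fun n => ?_)
      rw [← one_le_div (inv_pos.2 (choose_pos hα n)), weight_ratio hα, one_le_div (hpos n)]
      linarith
    · refine Or.inr (antitone_nat_of_succ_le fun n => ?_)
      rw [← div_le_one (inv_pos.2 (choose_pos hα n)), weight_ratio hα, div_le_one (hpos n)]
      linarith
  zero := by simp
  tendsto_ratio := by
    simp only [weight_ratio hα]
    have h := tendsto_natCast_div_add_atTop (𝕜 := ℝ) (-α)
    refine ((Filter.tendsto_add_atTop_iff_nat 1).2 h).congr fun n => ?_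
    push_cast
    ring
  summable_sq := by
    simp only [weight_ratio hα]
    have hs : Summable fun n : ℕ => α ^ 2 * (1 / |(n : ℝ) + (1 - α)| ^ (2 : ℝ)) :=
      ((Real.summable_one_div_nat_add_rpow (1 - α) 2).2 one_lt_two).mul_left _
    refine hs.congr fun n => ?_
    have h3 : (n : ℝ) + 1 - α ≠ 0 := by
      have : (0 : ℝ) ≤ n := n.cast_nonneg
      intro h
      linarith
    rw [Real.rpow_ofNat, sq_abs, ← add_sub_assoc]
    field_simp
    ring

/-! ### The candidate eigenvalues and eigenfunctions

In each of the following definitions the real parameter `ε` is the sign, `1` or `-1`. -/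

/-- `ρ_j = √(α² + 4 |a|² (j+1) (j+1-α))`. -/
def rho (α : ℝ) (a : ℂ) (j : ℕ) : ℝ :=
  Real.sqrt (α ^ 2 + 4 * ‖a‖ ^ 2 * (j + 1) * (j + 1 - α))

/-- `λ_j^± = |a|² + 1 + (α² ± (2j+2-α) ρ_j) / (2 (j+1) (j+1-α))`. -/
def eigval (α : ℝ) (a : ℂ) (ε : ℝ) (j : ℕ) : ℝ :=
  ‖a‖ ^ 2 + 1 + (α ^ 2 + ε * ((2 * j + 2 - α) * rho α a j)) / (2 * (j + 1) * (j + 1 - α))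

/-- `τ_j^± = ± (ρ_j ∓ α) / (2 (j+1))`. -/
def tau (α : ℝ) (a : ℂ) (ε : ℝ) (j : ℕ) : ℝ :=
  ε * ((rho α a j - ε * α) / (2 * (j + 1)))

/-- The function `(z + τ / conj a)^j / (1 + (τ / a) z)^(j+2-α)` with `τ = τ_j^±`; the power in the
denominator is the principal one. -/
def eigfun (α : ℝ) (a : ℂ) (ε : ℝ) (j : ℕ) (z : Disc) : ℂ :=
  ((z : ℂ) + (tau α a ε j : ℂ) / (starRingEnd ℂ) a) ^ j /
    (1 + (tau α a ε j : ℂ) / a * (z : ℂ)) ^ (((j : ℝ) + 2 - α : ℝ) : ℂ)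

/-- `ker (V_a - l I)` is one-dimensional, spanned by (an element of `H²_ω` given on the disc by)
the function `g`. -/
def EigenspaceSpannedBy {ω : ValidWeight} (T : H2 ω →L[ℂ] H2 ω) (l : ℂ) (g : Disc → ℂ) : Prop :=
  Module.finrank ℂ (eigenspace T l) = 1 ∧
    ∃ h : H2 ω, (∀ z : Disc, h z = g z) ∧ eigenspace T l = Submodule.span ℂ {h}

end WeightedHardy

end

namespace WeightedHardy

/-! ### The matrix of `V_a` in the monomial basis -/

/-! Pairing `V_a f = l f` with monomials and using `ω_{n+1}/ω_n = (n+1)/(n+1-α)` turns the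
eigenvalue equation into a three-term recurrence. As `a ≠ 0`, the zeroth coefficient determines a
solution, so eigenspaces have dimension at most one. The coefficients of the recurrence are affine
in `n`, so it amounts to a first-order linear differential equation `q f' = r f` with `q(z) = conj a
z² - m z + a`, where `m = |a|² - l + 1` is real because `V_a` is self-adjoint. The roots of `q` have
product `a / conj a`, of modulus one.

If `|m| ≤ 2|a|`, both roots lie on the unit circle. A virial identity bounds the energy of a nonzero
solution at index `N` below by a multiple of `1/(N+1)`, so the solution is not square-summable
(`coeff_zero_eq_zero_of_abs_le`).

If `|m| > 2|a|`, exactly one root `-t / conj a`, with `t` real and `|t| < |a|`, lies in the disc. A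
holomorphic solution vanishes there to some integer order `j`, and comparing leading terms of the
equation gives a quadratic equation for `t` (`TauEq`) with roots `τ_j^±`
(`exists_tauEq_of_eigenRec`). Conversely, when `|τ_j^±| < |a|`, the function `h_j^±` solves the
equation and is holomorphic beyond the closed disc, hence lies in the space (`eigfun_spans`). It
remains to decide when `|τ_j^±| < |a|`: always for the sign `+`, and for the sign `-` precisely when
`|a| > 1`. -/

/-- The right shift of a sequence. -/
def shift {R : Type*} [Zero R] (c : ℕ → R) : ℕ → R
  | 0 => 0
  | n + 1 => c n

@[simp] theorem shift_zero {R : Type*} [Zero R] (c : ℕ → R) : shift c 0 = 0 := rfl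

@[simp] theorem shift_succ {R : Type*} [Zero R] (c : ℕ → R) (n : ℕ) : shift c (n + 1) = c n := rfl

theorem hasSum_shift {c : ℕ → ℂ} {z s : ℂ} (h : HasSum (fun n => c n * z ^ n) s) :
    HasSum (fun n => shift c n * z ^ n) (z * s) := by
  rw [← hasSum_nat_add_iff' 1]
  convert! h.mul_left z using 1
  · funext n
    simp only [shift_succ, pow_succ]
    ring
  · simp

theorem coeff_M (ω : ValidWeight) (a : ℂ) (f : H2 ω) :
    coeff (M ω a f) = fun n => a * coeff f n - shift (coeff f) n := by
  refine (holomorphic_of_hasSum fun z => ?_).2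
  rw [M_apply, sub_mul]
  convert! ((f.holo.hasSum z).mul_left a).sub (hasSum_shift (f.holo.hasSum z)) using 1
  funext n
  ring

theorem exists_monomial (ω : ValidWeight) (n : ℕ) :
    ∃ e : H2 ω, coeff e = Pi.single n 1 := by
  obtain ⟨e, he⟩ := H2.exists_of_summable (ω := ω) (c := Pi.single n 1) (by
    refine summable_of_ne_finset_zero (s := {n}) fun m hm => ?_
    rw [Finset.mem_singleton] at hm
    simp [hm])
  exact ⟨e, funext he⟩

theorem inner_of_coeff_eq_single {ω : ValidWeight} {e : H2 ω} {n : ℕ}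
    (he : coeff e = Pi.single n 1) (g : H2 ω) : inner ℂ e g = coeff g n * ω n := by
  rw [H2.inner_def, tsum_eq_single n]
  · simp [he]
  · intro m hm
    simp [he, hm]

theorem coeff_V (ω : ValidWeight) (a : ℂ) (f : H2 ω) (n : ℕ) :
    coeff (V ω a f) n * ω n = (starRingEnd ℂ) a * (a * coeff f n - shift (coeff f) n) * ω n
      - (a * coeff f (n + 1) - coeff f n) * ω (n + 1) := by
  obtain ⟨e, he⟩ := exists_monomial ω n
  obtain ⟨e', he'⟩ := exists_monomial ω (n + 1)
  -- In monomials, `(a - z) z^n = a z^n - z^(n+1)`; moving `M` across the inner product therefore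
  -- leaves only the coefficients of `M f` at `n` and `n + 1`.
  have hM : M ω a e = a • e - e' := by
    refine H2.eq_of_coeff fun k => ?_
    have h1 : a • e - e' = a • e + (-1 : ℂ) • e' := by rw [neg_one_smul, sub_eq_add_neg]
    rw [coeff_M, h1, H2.coeff_add, H2.coeff_smul, H2.coeff_smul, he, he']
    cases k with
    | zero => simp
    | succ k =>
      simp only [Pi.single_apply, add_left_inj, shift_succ]
      split_ifs <;> simp [sub_eq_add_neg]
  have h2 : inner ℂ e (V ω a f) = inner ℂ (M ω a e) (M ω a f) :=
    ContinuousLinearMap.adjoint_inner_right (M ω a) e (M ω a f)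
  rw [inner_of_coeff_eq_single he, hM, inner_sub_left, inner_smul_left,
    inner_of_coeff_eq_single he, inner_of_coeff_eq_single he', coeff_M] at h2
  rw [h2]
  simp only [shift_succ]
  ring

/-! ### The eigenvalue equation as a three-term recurrence -/

theorem binomWeight_succ {α : ℝ} (hα : α < 1) (n : ℕ) :
    ((n : ℝ) + 1 - α) * binomWeight α hα (n + 1) = (n + 1) * binomWeight α hα n := by
  have h := weight_ratio hα n
  have h0 := (binomWeight α hα).pos n
  have h3 : (0 : ℝ) < (n : ℝ) + 1 - α := by
    have : (0 : ℝ) ≤ n := n.cast_nonneg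
    linarith
  change binomWeight α hα (n + 1) / binomWeight α hα n = _ at h
  rw [div_eq_div_iff h0.ne' h3.ne'] at h
  linarith

/-- The three-term recurrence satisfied by the coefficients of the eigenfunctions of `V_a`. -/
def EigenRec (α : ℝ) (a l : ℂ) (c : ℕ → ℂ) : Prop :=
  ∀ n : ℕ, a * (n + 1) * c (n + 1) = ((‖a‖ ^ 2 - l) * (n + 1 - α) + (n + 1)) * c n
    - (starRingEnd ℂ) a * (n + 1 - α) * shift c n

theorem mem_eigenspace_iff {α : ℝ} (hα : α < 1) (a l : ℂ) (f : H2 (binomWeight α hα)) :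
    f ∈ eigenspace (V (binomWeight α hα) a) l ↔ EigenRec α a l (coeff f) := by
  have key : ∀ n, coeff (V (binomWeight α hα) a f) n = l * coeff f n ↔
      a * (n + 1) * coeff f (n + 1) = ((‖a‖ ^ 2 - l) * (n + 1 - α) + (n + 1)) * coeff f n
        - (starRingEnd ℂ) a * (n + 1 - α) * shift (coeff f) n := by
    intro n
    have h0 : (binomWeight α hα n : ℂ) ≠ 0 := by
      exact_mod_cast ((binomWeight α hα).pos n).ne'
    have h3 : ((n : ℂ) + 1 - α) ≠ 0 := by
      have : (0 : ℝ) < (n : ℝ) + 1 - α := by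
        have : (0 : ℝ) ≤ n := n.cast_nonneg
        linarith
      exact_mod_cast this.ne'
    have hw : ((n : ℂ) + 1 - α) * binomWeight α hα (n + 1) = (n + 1) * binomWeight α hα n := by
      exact_mod_cast binomWeight_succ hα n
    have hV := coeff_V (binomWeight α hα) a f n
    have ha : (starRingEnd ℂ) a * a = ‖a‖ ^ 2 := Complex.conj_mul' a
    constructor
    · intro h
      rw [h] at hV
      apply mul_right_cancel₀ h0
      linear_combination ((n : ℂ) + 1 - α) * hV - (a * coeff f (n + 1) - coeff f n) * hw
        + ((n : ℂ) + 1 - α) * coeff f n * binomWeight α hα n * ha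
    · intro h
      apply mul_right_cancel₀ h0
      apply mul_left_cancel₀ h3
      linear_combination ((n : ℂ) + 1 - α) * hV - (a * coeff f (n + 1) - coeff f n) * hw
        + ((n : ℂ) + 1 - α) * coeff f n * binomWeight α hα n * ha - binomWeight α hα n * h
  rw [eigenspace, Module.End.mem_eigenspace_iff]
  constructor
  · intro h n
    refine (key n).1 ?_
    have h' : V (binomWeight α hα) a f = l • f := h
    rw [h', H2.coeff_smul]
  · intro h
    change V (binomWeight α hα) a f = l • f
    refine H2.eq_of_coeff fun n => ?_
    rw [H2.coeff_smul]
    exact (key n).2 (h n)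

/-- The leading factor `a (n + 1)` never vanishes and the term of index `-1` is zero, so the
recurrence propagates any proportionality of the zeroth coefficients. -/
theorem EigenRec.eq_smul {α : ℝ} {a l : ℂ} (ha : a ≠ 0) {c d : ℕ → ℂ} (hc : EigenRec α a l c)
    (hd : EigenRec α a l d) {k : ℂ} (h0 : c 0 = k * d 0) (n : ℕ) : c n = k * d n := by
  have step : ∀ n, c n = k * d n → shift c n = k * shift d n → c (n + 1) = k * d (n + 1) := by
    intro n h1 h2
    have h3 : a * ((n : ℂ) + 1) ≠ 0 := mul_ne_zero ha (Nat.cast_add_one_ne_zero n)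
    apply mul_left_cancel₀ h3
    have := hd n
    rw [hc n, h1, h2]
    linear_combination (-k) * this
  have main : ∀ n, c n = k * d n ∧ shift c n = k * shift d n := by
    intro n
    induction n with
    | zero => simp [h0]
    | succ n ih => exact ⟨step n ih.1 ih.2, ih.1⟩
  exact (main n).1

theorem eigenspaceSpannedBy_of_eigenRec {α : ℝ} (hα : α < 1) {a l : ℂ} (ha : a ≠ 0)
    (h : H2 (binomWeight α hα)) (hrec : EigenRec α a l (coeff h)) (h0 : coeff h 0 ≠ 0)
    {g : Disc → ℂ} (hg : ∀ z, h z = g z) :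
    EigenspaceSpannedBy (V (binomWeight α hα) a) l g := by
  have hspan : eigenspace (V (binomWeight α hα) a) l = Submodule.span ℂ {h} := by
    ext f
    rw [Submodule.mem_span_singleton, mem_eigenspace_iff]
    constructor
    · intro hf
      refine ⟨coeff f 0 / coeff h 0, H2.eq_of_coeff fun n => ?_⟩
      rw [H2.coeff_smul]
      exact (hf.eq_smul ha hrec (div_mul_cancel₀ _ h0).symm n).symm
    · rintro ⟨k, rfl⟩
      rw [← mem_eigenspace_iff hα]
      exact Submodule.smul_mem _ _ ((mem_eigenspace_iff hα a l h).2 hrec)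
  refine ⟨?_, h, hg, hspan⟩
  rw [hspan]
  refine finrank_span_singleton ?_
  rintro rfl
  exact h0 (congrFun coeff_zero.2 0)

theorem EigenspaceSpannedBy.mem_pointSpectrum {ω : ValidWeight} {T : H2 ω →L[ℂ] H2 ω} {l : ℂ}
    {g : Disc → ℂ} (h : EigenspaceSpannedBy T l g) : l ∈ pointSpectrum T := by
  change Module.End.eigenspace _ _ ≠ ⊥
  intro hb
  have := h.1
  rw [eigenspace, hb, finrank_bot] at this
  exact zero_ne_one this

/-- For an eigenvector, `l ‖f‖² = ⟨f, V f⟩ = ‖M f‖²` is real. Reality of `l` is what permits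
splitting according to the size of `|a|² - l + 1`. -/
theorem im_eq_zero_of_mem_pointSpectrum {ω : ValidWeight} {a l : ℂ}
    (hl : l ∈ pointSpectrum (V ω a)) : l.im = 0 := by
  obtain ⟨f, hf, hf0⟩ := Module.End.HasEigenvalue.exists_hasEigenvector hl
  have hV : V ω a f = l • f := Module.End.mem_eigenspace_iff.1 hf
  have h2 : inner ℂ f (V ω a f) = inner ℂ (M ω a f) (M ω a f) :=
    ContinuousLinearMap.adjoint_inner_right (M ω a) f (M ω a f)
  rw [hV, inner_smul_right, inner_self_eq_norm_sq_to_K, inner_self_eq_norm_sq_to_K] at h2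
  have h2' : l * ((‖f‖ ^ 2 : ℝ) : ℂ) = ((‖M ω a f‖ ^ 2 : ℝ) : ℂ) := by
    push_cast
    exact h2
  have h3 := congrArg Complex.im h2'
  rw [Complex.im_mul_ofReal, Complex.ofReal_im] at h3
  have : ‖f‖ ^ 2 ≠ 0 := by
    have := norm_ne_zero_iff.2 hf0
    positivity
  exact (mul_eq_zero.1 h3).resolve_right this

/-! ### The differential equation of the eigenfunctions -/

theorem coeff_deriv {f : Disc → ℂ} (hf : IsHolomorphic f) (z : Disc) :
    HasSum (fun n : ℕ => ((n : ℂ) + 1) * coeff f (n + 1) * (z : ℂ) ^ n) (deriv (ext f) z) := by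
  have h1 : DifferentiableOn ℂ (deriv (ext f)) Disc := hf.deriv Metric.isOpen_ball
  have h := Complex.hasSum_taylorSeries_on_ball h1 z.2
  convert! h using 1
  funext n
  rw [coeff, iteratedDeriv_succ', Nat.factorial_succ]
  have : (n.factorial : ℂ) ≠ 0 := by exact_mod_cast n.factorial_ne_zero
  have h2 := Nat.cast_add_one_ne_zero (R := ℂ) n
  simp only [sub_zero, smul_eq_mul]
  push_cast
  field_simp

/-- The two sides of the recurrence differ by the `n`-th Maclaurin coefficient of the difference of
the two sides of the differential equation: factors `n` come from the derivative, shifts from powers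
of `z`. -/
theorem eigenRec_iff_deriv {f : Disc → ℂ} (hf : IsHolomorphic f) (α : ℝ) (a l : ℂ) :
    EigenRec α a l (coeff f) ↔ ∀ z : Disc,
      ((starRingEnd ℂ) a * (z : ℂ) ^ 2 - (‖a‖ ^ 2 - l + 1) * z + a) * deriv (ext f) z
        = ((‖a‖ ^ 2 - l) * (1 - α) + 1 - (starRingEnd ℂ) a * (2 - α) * z) * f z := by
  set D : ℕ → ℂ := fun n => a * (n + 1) * coeff f (n + 1)
    - (((‖a‖ ^ 2 - l) * (n + 1 - α) + (n + 1)) * coeff f n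
    - (starRingEnd ℂ) a * (n + 1 - α) * shift (coeff f) n) with hD
  have hs : ∀ z : Disc, HasSum (fun n => D n * (z : ℂ) ^ n)
      (((starRingEnd ℂ) a * (z : ℂ) ^ 2 - (‖a‖ ^ 2 - l + 1) * z + a) * deriv (ext f) z
        - ((‖a‖ ^ 2 - l) * (1 - α) + 1 - (starRingEnd ℂ) a * (2 - α) * z) * f z) := by
    intro z
    have h0 := hf.hasSum z
    have h0' := hasSum_shift h0
    have h1 := coeff_deriv hf z
    have h2 := hasSum_shift h1
    have h3 := hasSum_shift h2
    have h := ((h1.mul_left a).sub (h2.mul_left (‖a‖ ^ 2 - l + 1))).add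
      (h3.mul_left ((starRingEnd ℂ) a))
    have h' := (h0.mul_left ((‖a‖ ^ 2 - l) * (1 - α) + 1)).sub
      (h0'.mul_left ((starRingEnd ℂ) a * (2 - α)))
    convert! h.sub h' using 1
    · funext n
      simp only [hD]
      rcases n with _ | _ | n
      · simp
      · simp; ring
      · simp; ring
    · ring
  have hiff : EigenRec α a l (coeff f) ↔ D = 0 := by
    rw [funext_iff]
    exact forall_congr' fun n => by simp only [hD, Pi.zero_apply, sub_eq_zero]
  rw [hiff]
  constructor
  · intro h z
    have h1 := hs z
    rw [h] at h1
    simp only [Pi.zero_apply, zero_mul] at h1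
    exact sub_eq_zero.1 (h1.unique hasSum_zero)
  · intro h
    have h1 := (holomorphic_of_hasSum (f := 0) (c := D) fun z => by
      have h2 := hs z
      rw [h z, sub_self] at h2
      exact h2).2
    rw [← h1, coeff_zero.2]

/-! ### Absence of eigenvectors in the continuous spectrum -/

/-- A discrete virial identity for solutions of the normalized real recurrence. -/
theorem virial_identity {α : ℝ} (hα : α < 1) {σ κ : ℝ} {x : ℕ → ℝ}
    (hx : ∀ n : ℕ, (n + 1) * x (n + 1) + (n + 1 - α) * shift x n = (σ * (n + 1) - κ) * x n)
    (N : ℕ) :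
    x 0 ^ 2 + ∑ m ∈ Finset.range N,
        binomWeight α hα (m + 1) * (x m ^ 2 + x (m + 1) ^ 2 - σ * (x m * x (m + 1)))
      = (N + 1) * (binomWeight α hα N * x N ^ 2 + binomWeight α hα (N + 1) * x (N + 1) ^ 2)
        - (σ * (N + 1) - κ) * (binomWeight α hα (N + 1) * (x N * x (N + 1))) := by
  induction N with
  | zero =>
    have h := hx 0
    simp only [shift_zero, CharP.cast_eq_zero, mul_zero, add_zero, zero_add, one_mul] at h
    simp only [Finset.range_zero, Finset.sum_empty, CharP.cast_eq_zero, zero_add,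
      (binomWeight α hα).zero]
    linear_combination (-(binomWeight α hα 1 * x 1)) * h
  | succ N ih =>
    rw [Finset.sum_range_succ, ← add_assoc, ih]
    have h := hx (N + 1)
    have hw0 := binomWeight_succ hα N
    have hw := binomWeight_succ hα (N + 1)
    simp only [shift_succ] at h
    push_cast at h hw ⊢
    -- The multiplier of the recurrence is a weighted central difference, the discrete counterpart
    -- of pairing an equation with a derivative of its solution.
    linear_combination (binomWeight α hα (N + 1) * x N
       - binomWeight α hα (N + 1 + 1) * x (N + 1 + 1)) * h + (x N * x (N + 1 + 1)) * hw
       - x N ^ 2 * hw0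

/-- For `|σ| ≤ 2` the quadratic form in the virial sum is nonnegative, so `x 0 ^ 2` is at most the
boundary term, which is `O(N + 1)` times the energy at `N` and `N + 1`. Summable energies would then
force the harmonic series to converge unless `x 0 = 0`. -/
theorem eq_zero_of_summable_of_abs_le_two {α : ℝ} (hα₀ : 0 < α) (hα : α < 1) {σ κ : ℝ}
    (hσ : |σ| ≤ 2) {x : ℕ → ℝ}
    (hx : ∀ n : ℕ, (n + 1) * x (n + 1) + (n + 1 - α) * shift x n = (σ * (n + 1) - κ) * x n)
    (hs : Summable fun n => x n ^ 2 * binomWeight α hα n) : x 0 = 0 := by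
  set ω := binomWeight α hα with hω
  have hpos := ω.pos
  have hratio : ∀ n, ω (n + 1) ≤ (1 - α)⁻¹ * ω n := by
    intro n
    have h := binomWeight_succ hα n
    rw [← hω] at h
    have hn : (0 : ℝ) ≤ n := n.cast_nonneg
    rw [inv_mul_eq_div, le_div_iff₀ (by linarith)]
    -- This uses `(n + 1)(1 - α) ≤ n + 1 - α`.
    have h1 : ((n : ℝ) + 1) * ((1 - α) * ω (n + 1)) ≤ (n + 1) * ω n := by
      rw [← h]
      have := (hpos (n + 1)).le
      nlinarith [mul_nonneg (mul_nonneg hn hα₀.le) this]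
    have := le_of_mul_le_mul_left h1 (by positivity)
    linarith
  -- The `1` accounts for the square terms of the boundary expression; the rest bounds its cross
  -- term, with `2 + |κ|` from `σ (N + 1) - κ` and `(1 - α)⁻¹` from the weight ratio.
  set C : ℝ := 1 + (2 + |κ|) * (1 - α)⁻¹ with hC
  have hi : 1 < (1 - α)⁻¹ := (one_lt_inv₀ (by linarith)).2 (by linarith)
  have hCpos : 0 < C := by have := abs_nonneg κ; positivity
  have hbound : ∀ N : ℕ, x 0 ^ 2 ≤ C * ((N + 1) * (x N ^ 2 * ω N + x (N + 1) ^ 2 * ω (N + 1))) := by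
    intro N
    have hv := virial_identity hα hx N
    rw [← hω] at hv
    have hsum : 0 ≤ ∑ m ∈ Finset.range N,
        ω (m + 1) * (x m ^ 2 + x (m + 1) ^ 2 - σ * (x m * x (m + 1))) := by
      refine Finset.sum_nonneg fun m _ => mul_nonneg (hpos _).le ?_
      obtain ⟨h1, h2⟩ := abs_le.1 hσ
      -- Here `4(x² + y² - σxy) = (2 - σ)(x + y)² + (2 + σ)(x - y)²`.
      nlinarith [mul_nonneg (by linarith : 0 ≤ 2 - σ) (sq_nonneg (x m + x (m + 1))),
        mul_nonneg (by linarith : 0 ≤ 2 + σ) (sq_nonneg (x m - x (m + 1)))]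
    have hN : (0 : ℝ) ≤ N := N.cast_nonneg
    have hcoef : |σ * (N + 1) - κ| ≤ (2 + |κ|) * (N + 1) := by
      refine (abs_sub _ _).trans ?_
      rw [abs_mul, abs_of_nonneg (by linarith : (0 : ℝ) ≤ N + 1)]
      have := abs_nonneg κ
      nlinarith
    have hcross : |ω (N + 1) * (x N * x (N + 1))|
        ≤ (1 - α)⁻¹ * (x N ^ 2 * ω N + x (N + 1) ^ 2 * ω (N + 1)) := by
      rw [abs_mul, abs_of_pos (hpos _)]
      have h1 : |x N * x (N + 1)| ≤ x N ^ 2 + x (N + 1) ^ 2 := by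
        rw [abs_le]
        constructor <;> nlinarith [sq_nonneg (x N + x (N + 1)), sq_nonneg (x N - x (N + 1)),
          sq_nonneg (x N), sq_nonneg (x (N + 1))]
      have h2 := mul_le_mul_of_nonneg_left h1 (hpos (N + 1)).le
      have h3 := mul_le_mul_of_nonneg_left (hratio N) (sq_nonneg (x N))
      have h4 : x (N + 1) ^ 2 * ω (N + 1) ≤ (1 - α)⁻¹ * (x (N + 1) ^ 2 * ω (N + 1)) :=
        le_mul_of_one_le_left (mul_nonneg (sq_nonneg _) (hpos _).le) hi.le
      linarith
    have hprod := mul_le_mul hcoef hcross (abs_nonneg _) (by positivity)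
    rw [← abs_mul] at hprod
    have := (abs_le.1 hprod).1
    rw [hC]
    linarith
  by_contra hne
  have hx0 : 0 < x 0 ^ 2 := by positivity
  have hs2 : Summable fun n : ℕ => x n ^ 2 * ω n + x (n + 1) ^ 2 * ω (n + 1) :=
    hs.add ((summable_nat_add_iff 1).2 hs)
  have hs3 : Summable fun n : ℕ => 1 / ((n : ℝ) + 1) := by
    refine Summable.of_nonneg_of_le (fun n => by positivity) (fun n => ?_)
      (hs2.mul_left (C / x 0 ^ 2))
    have h := hbound n
    rw [div_mul_eq_mul_div, div_le_div_iff₀ (by positivity) hx0]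
    linarith
  exact Real.not_summable_one_div_natCast ((summable_nat_add_iff 1).1 (by exact_mod_cast hs3))

/-- Rotating the coefficients by powers of `a/|a|` and dividing by the zeroth one makes the
recurrence real with initial value `1`. The real parts then satisfy the normalized recurrence with
`σ = (|a|² - l + 1)/|a|`, so `|σ| ≤ 2`, and stay square-summable. -/
theorem coeff_zero_eq_zero_of_abs_le {α : ℝ} (hα₀ : 0 < α) (hα : α < 1) {a : ℂ} (ha : a ≠ 0)
    {l : ℝ} (hl : |‖a‖ ^ 2 - l + 1| ≤ 2 * ‖a‖) (f : H2 (binomWeight α hα))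
    (hf : EigenRec α a l (coeff f)) : coeff f 0 = 0 := by
  by_contra hne
  have hna : 0 < ‖a‖ := norm_pos_iff.2 ha
  set u : ℂ := a / ‖a‖ with hu
  have hnaC : (‖a‖ : ℂ) ≠ 0 := by exact_mod_cast hna.ne'
  have hun : ‖u‖ = 1 := by
    rw [hu, norm_div, Complex.norm_real, norm_norm, div_self hna.ne']
  have hau : a = ‖a‖ * u := by rw [hu]; field_simp
  have hcu : (starRingEnd ℂ) a * u = ‖a‖ := by
    rw [hu, mul_div_assoc', Complex.conj_mul', sq, mul_div_assoc, div_self hnaC, mul_one]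
  set y : ℕ → ℂ := fun n => u ^ n * coeff f n / coeff f 0 with hy
  set x : ℕ → ℝ := fun n => (y n).re with hxdef
  have hyrec : ∀ n : ℕ, ((n : ℂ) + 1) * y (n + 1) + (n + 1 - α) * shift y n
      = (((‖a‖ ^ 2 - l + 1) / ‖a‖ : ℝ) * (n + 1) - (α * (‖a‖ ^ 2 - l) / ‖a‖ : ℝ)) * y n := by
    intro n
    have h := hf n
    have hshift : (‖a‖ : ℂ) * shift y n
        = (starRingEnd ℂ) a * u ^ n * shift (coeff f) n / coeff f 0 := by
      cases n with
      | zero => simp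
      | succ n =>
        simp only [shift_succ, hy]
        rw [← hcu]
        ring
    have h1 : a * (u ^ n * coeff f (n + 1) / coeff f 0) = ‖a‖ * y (n + 1) := by
      simp only [hy]
      rw [hau]
      simp only [norm_mul, Complex.norm_real, norm_norm, hun, mul_one]
      ring
    push_cast
    have h2 : (((‖a‖ : ℂ) ^ 2 - l + 1) / ‖a‖ * (n + 1) - α * (‖a‖ ^ 2 - l) / ‖a‖) * y n
        = (((‖a‖ : ℂ) ^ 2 - l) * (n + 1 - α) + (n + 1)) * y n / ‖a‖ := by
      field_simp
      ring
    rw [h2, eq_div_iff hnaC]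
    have h3 := congrArg (fun w => u ^ n / coeff f 0 * w) h
    simp only [hy] at h1 hshift ⊢
    linear_combination h3 - (n + 1) * h1 + ((n : ℂ) + 1 - α) * hshift
  have hxrec : ∀ n : ℕ, ((n : ℝ) + 1) * x (n + 1) + (n + 1 - α) * shift x n
      = ((‖a‖ ^ 2 - l + 1) / ‖a‖ * (n + 1) - α * (‖a‖ ^ 2 - l) / ‖a‖) * x n := by
    intro n
    have h := congrArg Complex.re (hyrec n)
    have hsh : shift x n = (shift y n).re := by cases n <;> simp [hxdef]
    rw [hsh]
    have e1 : ((n : ℂ) + 1) = ((n + 1 : ℝ) : ℂ) := by push_cast; ring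
    rw [e1, ← Complex.ofReal_sub, ← Complex.ofReal_mul, ← Complex.ofReal_sub, Complex.add_re,
      Complex.re_ofReal_mul, Complex.re_ofReal_mul, Complex.re_ofReal_mul] at h
    exact h
  have hsum : Summable fun n => x n ^ 2 * binomWeight α hα n := by
    refine Summable.of_nonneg_of_le
      (fun n => mul_nonneg (sq_nonneg _) ((binomWeight α hα).pos n).le) (fun n => ?_)
      (f.summable.mul_left ((‖coeff f 0‖ ^ 2)⁻¹))
    rw [← mul_assoc]
    refine mul_le_mul_of_nonneg_right ?_ ((binomWeight α hα).pos n).le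
    have h1 : ‖y n‖ ^ 2 = (‖coeff f 0‖ ^ 2)⁻¹ * ‖coeff f n‖ ^ 2 := by
      simp only [hy, norm_div, norm_mul, norm_pow, hun, one_pow, one_mul, div_pow]
      ring
    rw [← h1, ← sq_abs]
    exact pow_le_pow_left₀ (abs_nonneg _) (Complex.abs_re_le_norm _) 2
  have h0 := eq_zero_of_summable_of_abs_le_two hα₀ hα (by
    rw [abs_div, abs_of_pos hna, div_le_iff₀ hna]
    exact hl) hxrec hsum
  simp [hxdef, hy, div_self hne] at h0

/-! ### The numbers `τ_j^±` and `λ_j^±` -/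

theorem two_mul_tau {α : ℝ} {a : ℂ} {ε : ℝ} (hε : ε ^ 2 = 1) (j : ℕ) :
    2 * (j + 1) * tau α a ε j + α = ε * rho α a j := by
  have : (j : ℝ) + 1 ≠ 0 := Nat.cast_add_one_ne_zero j
  rw [tau]
  field_simp
  linear_combination (-α) * hε

theorem rho_sq {α : ℝ} (hα : α < 1) (a : ℂ) (j : ℕ) :
    rho α a j ^ 2 = α ^ 2 + 4 * ‖a‖ ^ 2 * (j + 1) * (j + 1 - α) := by
  have hj : (0 : ℝ) ≤ j := j.cast_nonneg
  have : 0 ≤ (j : ℝ) + 1 - α := by linarith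
  exact Real.sq_sqrt (by positivity)

/-- The quadratic equation satisfied by `τ_j^±`. -/
def TauEq (α A : ℝ) (j : ℕ) (t : ℝ) : Prop :=
  (j + 1) * t ^ 2 + α * t = (j + 1 - α) * A ^ 2

theorem tauEq_tau {α : ℝ} (hα : α < 1) (a : ℂ) {ε : ℝ} (hε : ε ^ 2 = 1) (j : ℕ) :
    TauEq α ‖a‖ j (tau α a ε j) := by
  have h1 := two_mul_tau (α := α) (a := a) hε j
  have h2 := rho_sq hα a j
  have h3 : (4 * ((j : ℝ) + 1)) ≠ 0 := by positivity
  apply mul_left_cancel₀ h3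
  linear_combination (2 * (j + 1) * tau α a ε j + α + ε * rho α a j) * h1
    + rho α a j ^ 2 * hε + h2

theorem TauEq.eq_tau {α : ℝ} (hα : α < 1) {a : ℂ} {j : ℕ} {t : ℝ} (h : TauEq α ‖a‖ j t) :
    t = tau α a 1 j ∨ t = tau α a (-1) j := by
  have h1 := two_mul_tau (α := α) (a := a) (ε := 1) (by norm_num) j
  have h2 := two_mul_tau (α := α) (a := a) (ε := -1) (by norm_num) j
  have h3 := rho_sq hα a j
  have hj : 2 * ((j : ℝ) + 1) ≠ 0 := by positivity
  have h4 : (2 * (j + 1) * t + α) ^ 2 = rho α a j ^ 2 := by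
    unfold TauEq at h
    linear_combination 4 * ((j : ℝ) + 1) * h - h3
  refine (sq_eq_sq_iff_eq_or_eq_neg.1 h4).imp (fun h5 => ?_) fun h5 => ?_
  · apply mul_left_cancel₀ hj
    linarith
  · apply mul_left_cancel₀ hj
    linarith

theorem lt_rho {α : ℝ} (hα : α < 1) {a : ℂ} (ha : a ≠ 0) (j : ℕ) :
    α < rho α a j := by
  have hj : (0 : ℝ) ≤ j := j.cast_nonneg
  have h1 : 0 < (j : ℝ) + 1 - α := by linarith
  have h2 := norm_pos_iff.2 ha
  refine Real.lt_sqrt_of_sq_lt ?_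
  have : 0 < 4 * ‖a‖ ^ 2 * (j + 1) * (j + 1 - α) := by positivity
  linarith

theorem tau_one_pos {α : ℝ} (hα : α < 1) {a : ℂ} (ha : a ≠ 0) (j : ℕ) :
    0 < tau α a 1 j := by
  have := lt_rho hα ha j
  rw [tau, one_mul, one_mul]
  have h : 0 < rho α a j - α := by linarith
  positivity

theorem tau_neg_one_neg {α : ℝ} (hα₀ : 0 < α) (hα : α < 1) {a : ℂ} (ha : a ≠ 0) (j : ℕ) :
    tau α a (-1) j < 0 := by
  have := lt_rho hα ha j
  rw [tau, neg_one_mul, neg_one_mul, sub_neg_eq_add]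
  have h : 0 < rho α a j + α := by linarith
  have : 0 < (rho α a j + α) / (2 * (j + 1)) := by positivity
  linarith

/-- If `|t| ≥ A`, the left side of `TauEq` is too large: for `t > 0` this is immediate, and for `t ≤
0`, `A > 1` gives `|t| < t²`, so it exceeds `(j + 1 - α) t²`. -/
theorem TauEq.abs_lt {α A t : ℝ} (hα₀ : 0 < α) (hα : α < 1) (hA : 0 < A) {j : ℕ}
    (h : TauEq α A j t) (ht : 0 < t ∨ 1 < A) : |t| < A := by
  have hj : (0 : ℝ) ≤ j := j.cast_nonneg
  unfold TauEq at h
  by_contra hcon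
  push Not at hcon
  have h2 : 0 ≤ t ^ 2 - A ^ 2 := by
    rw [← sq_abs t]
    nlinarith
  have h3 := mul_nonneg hj h2
  have hA2 : 0 < A ^ 2 := by positivity
  rcases le_or_gt t 0 with h0 | h0
  · have h1 : 1 < A := ht.resolve_left (not_lt.2 h0)
    rw [abs_of_nonpos h0] at hcon
    have h4 : -t < t ^ 2 := by nlinarith
    nlinarith
  · nlinarith [mul_pos hα₀ h0, mul_pos hα₀ hA2]

/-- For `t ≤ 0` and `|t| < A ≤ 1` one has `t² ≤ |t|`, so the left side of `TauEq` is at most `(j + 1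
- α) t²`, below the right side. This excludes the minus branch when `|a| ≤ 1`. -/
theorem TauEq.pos {α A t : ℝ} (hα₀ : 0 < α) (hα : α < 1) (hA : A ≤ 1) {j : ℕ}
    (h : TauEq α A j t) (ht : |t| < A) : 0 < t := by
  have hj : (0 : ℝ) ≤ j := j.cast_nonneg
  unfold TauEq at h
  by_contra hcon
  push Not at hcon
  rw [abs_of_nonpos hcon] at ht
  have h2 : 0 < A ^ 2 - t ^ 2 := by nlinarith
  have h3 := mul_nonneg hj h2.le
  have h4 : t ^ 2 ≤ -t := by nlinarith
  nlinarith [mul_nonneg hα₀.le (sub_nonneg.2 h4), mul_pos (sub_pos.2 hα) h2]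

theorem TauEq.ne_zero {α A t : ℝ} (hα : α < 1) (hA : 0 < A) {j : ℕ}
    (h : TauEq α A j t) : t ≠ 0 := by
  rintro rfl
  have hj : (0 : ℝ) ≤ j := j.cast_nonneg
  have h1 : 0 < (j : ℝ) + 1 - α := by linarith
  have h2 : 0 < ((j : ℝ) + 1 - α) * A ^ 2 := by positivity
  unfold TauEq at h
  linarith

/-- This symmetric form matches the factorization of the leading polynomial. Dividing `TauEq` by `t`
makes `|a|²/t` affine in `t`, and `two_mul_tau` then brings in `ρ_j`. -/
theorem eigval_eq {α : ℝ} (hα : α < 1) {a : ℂ} (ha : a ≠ 0) {ε : ℝ} (hε : ε ^ 2 = 1) (j : ℕ) :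
    eigval α a ε j = ‖a‖ ^ 2 + 1 + tau α a ε j + ‖a‖ ^ 2 / tau α a ε j := by
  have hT := tauEq_tau hα a hε j
  have ht := hT.ne_zero hα (norm_pos_iff.2 ha)
  have h1 := two_mul_tau (α := α) (a := a) hε j
  have hj : (0 : ℝ) ≤ j := j.cast_nonneg
  have h2 : (j : ℝ) + 1 - α ≠ 0 := by
    intro h
    linarith
  have h3 : ‖a‖ ^ 2 / tau α a ε j = ((j + 1) * tau α a ε j + α) / (j + 1 - α) := by
    rw [div_eq_div_iff ht h2]
    unfold TauEq at hT
    linear_combination (-1 : ℝ) * hT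
  have h4 : (j : ℝ) + 1 ≠ 0 := Nat.cast_add_one_ne_zero j
  rw [h3, eigval, mul_left_comm, ← h1]
  field_simp
  ring

/-! ### Eigenvalues outside the continuous spectrum -/

/-- The polynomial `t² + m t + A²` has distinct real roots with product `A²`; `t` is the one of
smaller modulus. -/
theorem exists_roots_of_two_mul_lt_abs {A m : ℝ} (hA : 0 < A) (hm : 2 * A < |m|) :
    ∃ t : ℝ, t ≠ 0 ∧ |t| < A ∧ m = -(t + A ^ 2 / t) := by
  have hd : 0 < m ^ 2 - 4 * A ^ 2 := by
    rw [← sq_abs]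
    nlinarith
  set d := Real.sqrt (m ^ 2 - 4 * A ^ 2) with hdd
  have hd0 : 0 < d := Real.sqrt_pos.2 hd
  have hd2 : d ^ 2 = m ^ 2 - 4 * A ^ 2 := Real.sq_sqrt hd.le
  have hA2 : 0 < A ^ 2 := by positivity
  have finish : ∀ t, t ^ 2 + m * t + A ^ 2 = 0 → t ^ 2 < A ^ 2 →
      t ≠ 0 ∧ |t| < A ∧ m = -(t + A ^ 2 / t) := by
    intro t h1 h2
    have h0 : t ≠ 0 := by
      rintro rfl
      norm_num at h1
      exact hA.ne' h1
    refine ⟨h0, abs_lt_of_sq_lt_sq h2 hA.le, ?_⟩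
    field_simp
    linear_combination h1
  rcases le_or_gt m 0 with h | h
  · rw [abs_of_nonpos h] at hm
    refine ⟨(-m - d) / 2, finish _ (by linear_combination hd2 / 4) ?_⟩
    nlinarith
  · rw [abs_of_pos h] at hm
    refine ⟨(-m + d) / 2, finish _ (by linear_combination hd2 / 4) ?_⟩
    nlinarith

/-- The differential equation has a simple singular point `z₀` inside the disc, and the order of
vanishing of `f` there must equal its indicial exponent. That this exponent is a natural number is
`TauEq`. -/
theorem exists_tauEq_of_eigenRec {α : ℝ} {a : ℂ} (ha : a ≠ 0) {l : ℝ}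
    (hl : 2 * ‖a‖ < |‖a‖ ^ 2 - l + 1|) {f : Disc → ℂ} (hf : IsHolomorphic f) (hf0 : f ≠ 0)
    (hrec : EigenRec α a l (coeff f)) :
    ∃ (j : ℕ) (t : ℝ), TauEq α ‖a‖ j t ∧ |t| < ‖a‖ ∧ l = ‖a‖ ^ 2 + 1 + t + ‖a‖ ^ 2 / t := by
  have hna := norm_pos_iff.2 ha
  obtain ⟨t, ht0, hta, hm⟩ := exists_roots_of_two_mul_lt_abs hna hl
  have hode := (eigenRec_iff_deriv hf α a l).1 hrec
  have hca : (starRingEnd ℂ) a ≠ 0 := (map_ne_zero _).2 ha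
  have htC : (t : ℂ) ≠ 0 := by exact_mod_cast ht0
  have hmC : (‖a‖ : ℂ) ^ 2 - l + 1 = -(t + ‖a‖ ^ 2 / t) := by exact_mod_cast hm
  have haa : (starRingEnd ℂ) a * a = ‖a‖ ^ 2 := Complex.conj_mul' a
  set z₀ : ℂ := -(t / (starRingEnd ℂ) a) with hz₀
  have hcz : (starRingEnd ℂ) a * z₀ = -t := by
    rw [hz₀]
    field_simp
  have hz₀mem : z₀ ∈ Disc := by
    rw [mem_ball_zero_iff, hz₀, norm_neg, norm_div, RCLike.norm_conj, Complex.norm_real,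
      Real.norm_eq_abs, div_lt_one hna]
    exact hta
  have hopen : Disc ∈ nhds z₀ := Metric.isOpen_ball.mem_nhds hz₀mem
  have han : AnalyticOnNhd ℂ (ext f) Disc := hf.analyticOnNhd Metric.isOpen_ball
  -- By the identity theorem `f` vanishes to finite order at `z₀`.
  have hne : ¬ ∀ᶠ z in nhds z₀, ext f z = 0 := by
    intro h
    have h1 := han.eqOn_zero_of_preconnected_of_eventuallyEq_zero
      (convex_ball (0 : ℂ) 1).isPreconnected hz₀mem h
    refine hf0 (funext fun z => ?_)
    rw [← ext_apply f z, h1 z.2]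
    rfl
  obtain ⟨n, g, hg, hg0, hfg⟩ :=
    (han z₀ hz₀mem).exists_eventuallyEq_pow_smul_nonzero_iff.2 hne
  have hq : ∀ z : ℂ, (starRingEnd ℂ) a * z ^ 2 - (‖a‖ ^ 2 - l + 1) * z + a
      = (z - z₀) * ((starRingEnd ℂ) a * z + ‖a‖ ^ 2 / t) := by
    intro z
    apply mul_left_cancel₀ hca
    rw [hmC]
    linear_combination haa + (starRingEnd ℂ a * z + ‖a‖ ^ 2 / t) * hcz
      + (‖a‖ ^ 2 : ℂ) * (mul_inv_cancel₀ htC) * (-1)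
  -- The extra factor `z - z₀` avoids the exponent `n - 1`, so that `n = 0` is covered.
  have hder : ∀ᶠ z in nhds z₀, (z - z₀) * deriv (ext f) z
      = (z - z₀) ^ n * (n * g z + (z - z₀) * deriv g z) := by
    have h1 : ∀ᶠ z in nhds z₀, ext f =ᶠ[nhds z] fun w => (w - z₀) ^ n • g w :=
      eventually_eventually_nhds.2 hfg
    filter_upwards [h1, hg.eventually_analyticAt] with z h2 h3
    have h4 : HasDerivAt (fun w => (w - z₀) ^ n • g w)
        ((n * (z - z₀) ^ (n - 1) * 1) * g z + (z - z₀) ^ n * deriv g z) z :=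
      (((hasDerivAt_id z).sub_const z₀).pow n).mul h3.differentiableAt.hasDerivAt
    rw [h2.deriv_eq, h4.deriv]
    cases n with
    | zero => simp
    | succ n =>
      simp only [Nat.add_sub_cancel]
      ring
  set p : ℂ → ℂ := fun z => ((starRingEnd ℂ) a * z + ‖a‖ ^ 2 / t) * (n * g z + (z - z₀) * deriv g z)
    with hp
  set r : ℂ → ℂ := fun z =>
    ((‖a‖ ^ 2 - l) * (1 - α) + 1 - (starRingEnd ℂ) a * (2 - α) * z) * g z with hr
  -- The power `(z - z₀) ^ n` cancels only off `z₀`; continuity then carries the equality to `z₀`,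
  -- where it becomes the indicial equation.
  have hpr : p =ᶠ[nhdsWithin z₀ {z₀}ᶜ] r := by
    filter_upwards [nhdsWithin_le_nhds hder, nhdsWithin_le_nhds hfg, nhdsWithin_le_nhds hopen,
      self_mem_nhdsWithin] with z h1 h2 h3 h4
    have h5 : (z - z₀) ^ n ≠ 0 := pow_ne_zero _ (sub_ne_zero.2 h4)
    have h6 := hode ⟨z, h3⟩
    rw [← ext_apply f ⟨z, h3⟩] at h6
    simp only [hq, h2, smul_eq_mul] at h6
    apply mul_left_cancel₀ h5
    simp only [hp, hr]
    linear_combination h6 - ((starRingEnd ℂ) a * z + ‖a‖ ^ 2 / t) * h1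
  have hgc := hg.continuousAt
  have hgc' := hg.deriv.continuousAt
  have hpc : ContinuousAt p z₀ := by simp only [hp]; fun_prop
  have hrc : ContinuousAt r z₀ := by simp only [hr]; fun_prop
  have heq : p z₀ = r z₀ :=
    tendsto_nhds_unique ((hpc.tendsto.mono_left nhdsWithin_le_nhds).congr' hpr)
      (hrc.tendsto.mono_left nhdsWithin_le_nhds)
  simp only [hp, hr, sub_self, zero_mul, add_zero, ← mul_assoc] at heq
  have heq' := mul_right_cancel₀ hg0 heq
  have hμ : (‖a‖ : ℂ) ^ 2 - l = -(t + ‖a‖ ^ 2 / t) - 1 := by linear_combination hmC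
  have hlast : (-t + (‖a‖ : ℂ) ^ 2 / t) * n
      = (-(t + ‖a‖ ^ 2 / t) - 1) * (1 - α) + 1 + t * (2 - α) := by
    rw [← hμ]
    linear_combination heq' + (-(n : ℂ) - (2 - α)) * hcz
  have hlastR : (-t + ‖a‖ ^ 2 / t) * n = (-(t + ‖a‖ ^ 2 / t) - 1) * (1 - α) + 1 + t * (2 - α) := by
    exact_mod_cast hlast
  refine ⟨n, t, ?_, hta, by linarith⟩
  unfold TauEq
  field_simp at hlastR
  linear_combination (-1 : ℝ) * hlastR

/-! ### The eigenfunctions -/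

/-- Convergence beyond the unit circle makes the coefficients decay geometrically, while `ω (n+1) /
ω n → 1` keeps the weights subexponential. -/
theorem memH2_of_differentiableOn_ball {ω : ValidWeight} {f : Disc → ℂ} {G : ℂ → ℂ} {R : ℝ}
    (hR : 1 < R) (hG : DifferentiableOn ℂ G (Metric.ball 0 R)) (hfG : ∀ z : Disc, f z = G z) :
    MemH2 ω f := by
  set c : ℕ → ℂ := fun n => (n.factorial : ℂ)⁻¹ * iteratedDeriv n G 0 with hc
  have hsum : ∀ z ∈ Metric.ball (0 : ℂ) R, HasSum (fun n => c n * z ^ n) (G z) := by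
    intro z hz
    convert! Complex.hasSum_taylorSeries_on_ball hG hz using 1
    funext n
    simp only [hc, sub_zero, smul_eq_mul]
    ring
  obtain ⟨h1, h2⟩ := holomorphic_of_hasSum (f := f) (c := c) fun z => by
    rw [hfG]
    exact hsum z (Metric.ball_subset_ball hR.le z.2)
  refine ⟨h1, ?_⟩
  rw [h2]
  obtain ⟨r, hr1, hrR⟩ := exists_between hR
  have hr0 : 0 < r := by linarith
  have hbdd := (hsum (r : ℂ)
    (by simpa [abs_of_pos hr0] using hrR)).summable.tendsto_atTop_zero.norm.bddAbove_range
  obtain ⟨C, hC⟩ := hbdd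
  have hC' : ∀ n, ‖c n‖ * r ^ n ≤ C := fun n => by
    have := hC ⟨n, rfl⟩
    simpa [abs_of_pos hr0] using this
  have hw : Summable fun n => ω n * ((r ^ 2)⁻¹) ^ n := by
    refine summable_of_ratio_test_tendsto_lt_one (l := (r ^ 2)⁻¹)
      (inv_lt_one_of_one_lt₀ (by nlinarith))
      (Filter.Eventually.of_forall fun n => by have := ω.pos n; positivity) ?_
    have h3 := ω.tendsto_ratio.mul_const ((r ^ 2)⁻¹)
    rw [one_mul] at h3
    refine h3.congr fun n => ?_
    have h4 := ω.pos n
    have h5 := ω.pos (n + 1)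
    have h6 : 0 < (r ^ 2)⁻¹ := by positivity
    generalize (r ^ 2)⁻¹ = q at h6
    rw [Real.norm_of_nonneg (by positivity), Real.norm_of_nonneg (by positivity)]
    field_simp
    ring
  refine Summable.of_nonneg_of_le (fun n => mul_nonneg (sq_nonneg _) (ω.pos n).le) (fun n => ?_)
    (hw.mul_left (C ^ 2))
  have h3 : ‖c n‖ ^ 2 ≤ C ^ 2 * ((r ^ 2)⁻¹) ^ n := by
    rw [inv_pow, ← div_eq_mul_inv, le_div_iff₀ (by positivity), ← pow_mul, mul_comm 2 n, pow_mul,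
      ← mul_pow]
    exact pow_le_pow_left₀ (by positivity) (hC' n) 2
  have := mul_le_mul_of_nonneg_right h3 (ω.pos n).le
  linarith

theorem eigfun_spans {α : ℝ} (hα : α < 1) {a : ℂ} (ha : a ≠ 0) {ε : ℝ} (hε : ε ^ 2 = 1) (j : ℕ)
    (hlt : |tau α a ε j| < ‖a‖) :
    EigenspaceSpannedBy (V (binomWeight α hα) a) (eigval α a ε j : ℂ) (eigfun α a ε j) := by
  have hna := norm_pos_iff.2 ha
  have hT := tauEq_tau hα a hε j
  have ht0 := hT.ne_zero hα hna
  have hev := eigval_eq hα ha hε j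
  set t := tau α a ε j with ht
  have htC : (t : ℂ) ≠ 0 := by exact_mod_cast ht0
  have hca : (starRingEnd ℂ) a ≠ 0 := (map_ne_zero _).2 ha
  have haa : (starRingEnd ℂ) a * a = ‖a‖ ^ 2 := Complex.conj_mul' a
  set s : ℂ := t / a with hs
  set b : ℂ := t / (starRingEnd ℂ) a with hb
  set k : ℂ := (((j : ℝ) + 2 - α : ℝ) : ℂ) with hk
  set G : ℂ → ℂ := fun z => (z + b) ^ j * (1 + s * z) ^ (-k) with hG
  have hsn : ‖s‖ = |t| / ‖a‖ := by
    rw [hs, norm_div, Complex.norm_real, Real.norm_eq_abs]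
  have hspos : 0 < ‖s‖ := by
    rw [hsn]
    have := abs_pos.2 ht0
    positivity
  have hs1 : ‖s‖ < 1 := by rwa [hsn, div_lt_one hna]
  -- The radius `‖s‖⁻¹ > 1` is the modulus of the other root `-1/s`; inside it `1 + s z` stays in
  -- the right half-plane, off the branch cut.
  have hslit : ∀ z ∈ Metric.ball (0 : ℂ) ‖s‖⁻¹, 1 + s * z ∈ Complex.slitPlane := by
    intro z hz
    refine Complex.mem_slitPlane_of_norm_lt_one ?_
    rw [mem_ball_zero_iff] at hz
    rw [norm_mul, ← mul_inv_cancel₀ hspos.ne']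
    exact mul_lt_mul_of_pos_left hz hspos
  have hderiv : ∀ z ∈ Metric.ball (0 : ℂ) ‖s‖⁻¹, HasDerivAt G
      ((j * (z + b) ^ (j - 1) * 1) * (1 + s * z) ^ (-k)
        + (z + b) ^ j * (-k * (1 + s * z) ^ (-k - 1) * (s * 1))) z := by
    intro z hz
    exact (((hasDerivAt_id z).add_const b).pow j).mul
      ((((hasDerivAt_id z).const_mul s).const_add 1).cpow_const (hslit z hz))
  have hsub : Disc ⊆ Metric.ball (0 : ℂ) ‖s‖⁻¹ :=
    Metric.ball_subset_ball ((one_lt_inv₀ hspos).2 hs1).le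
  have hfG : ∀ z : Disc, eigfun α a ε j z = G z := by
    intro z
    simp only [hG, eigfun, Complex.cpow_neg, div_eq_mul_inv]
    rfl
  have hmem : MemH2 (binomWeight α hα) (eigfun α a ε j) :=
    memH2_of_differentiableOn_ball ((one_lt_inv₀ hspos).2 hs1)
      (fun z hz => (hderiv z hz).differentiableAt.differentiableWithinAt) hfG
  refine eigenspaceSpannedBy_of_eigenRec hα ha ⟨eigfun α a ε j, hmem⟩ ?_ ?_ fun z => rfl
  · refine (eigenRec_iff_deriv hmem.1 α a _).2 fun z => ?_
    have hext : ext (eigfun α a ε j) =ᶠ[nhds (z : ℂ)] G := by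
      filter_upwards [Metric.isOpen_ball.mem_nhds z.2] with w hw
      rw [show ext (eigfun α a ε j) w = eigfun α a ε j ⟨w, hw⟩ from ext_apply _ ⟨w, hw⟩, hfG]
    have hne : (1 + s * (z : ℂ)) ≠ 0 := Complex.slitPlane_ne_zero (hslit z (hsub z.2))
    have hpow : (1 + s * (z : ℂ)) ^ (-k) = (1 + s * z) * (1 + s * (z : ℂ)) ^ (-k - 1) := by
      rw [Complex.cpow_sub _ _ hne, Complex.cpow_one, mul_div_cancel₀ _ hne]
    have hj : ((z : ℂ) + b) * (j * ((z : ℂ) + b) ^ (j - 1)) = j * (z + b) ^ j := by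
      cases j with
      | zero => simp
      | succ n => simp only [Nat.add_sub_cancel]; ring
    -- The roots of the leading polynomial are the zero `-b` and the branch point `-1/s` of the
    -- eigenfunction.
    have hmul : ((starRingEnd ℂ) a * (z : ℂ) ^ 2 - (‖a‖ ^ 2 - (eigval α a ε j : ℂ) + 1) * z + a)
        = ‖a‖ ^ 2 / t * (z + b) * (1 + s * z) := by
      rw [hev]
      push_cast
      rw [← haa, hb, hs]
      field_simp
      ring
    -- After factoring, this is the logarithmic derivative of `G` times the leading polynomial; the
    -- constant terms agree exactly by `TauEq`.
    have hcoef : (‖a‖ : ℂ) ^ 2 / t * (j * (1 + s * z) - k * s * (z + b))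
        = (‖a‖ ^ 2 - (eigval α a ε j : ℂ)) * (1 - α) + 1 - (starRingEnd ℂ) a * (2 - α) * z := by
      have hT' : ((j : ℝ) + 1) * t ^ 2 + α * t = (j + 1 - α) * ‖a‖ ^ 2 := hT
      have hTC : ((j : ℂ) + 1) * t ^ 2 + α * t = (j + 1 - α) * ‖a‖ ^ 2 := by exact_mod_cast hT'
      rw [hev, hk]
      push_cast
      rw [← haa] at hTC ⊢
      rw [hb, hs]
      field_simp
      linear_combination (-1 : ℂ) * hTC
    rw [hext.deriv_eq, (hderiv z (hsub z.2)).deriv, hfG, hmul, ← hcoef]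
    simp only [hG]
    rw [hpow]
    linear_combination (‖a‖ : ℂ) ^ 2 / t * (1 + s * z) ^ 2 * (1 + s * (z : ℂ)) ^ (-k - 1) * hj
  · have h0 : coeff (eigfun α a ε j) 0 = G 0 := by
      have hz : (0 : ℂ) ∈ Disc := by simp
      rw [coeff, iteratedDeriv_zero, Nat.factorial_zero, Nat.cast_one, div_one]
      exact (ext_apply _ ⟨0, hz⟩).trans (hfG ⟨0, hz⟩)
    change coeff (eigfun α a ε j) 0 ≠ 0
    rw [h0]
    simp [hG, hb, htC, hca]

/-! ### Determination of the point spectrum -/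

/-- Every eigenvalue of `V_a` is of the form `λ_j^±` with `|τ_j^±| < |a|`. -/
theorem exists_eigval_of_mem_pointSpectrum {α : ℝ} (hα₀ : 0 < α) (hα : α < 1) {a : ℂ} (ha : a ≠ 0)
    {l : ℂ} (hl : l ∈ pointSpectrum (V (binomWeight α hα) a)) :
    ∃ j : ℕ, ∃ ε : ℝ, (ε = 1 ∨ ε = -1) ∧ |tau α a ε j| < ‖a‖ ∧ l = (eigval α a ε j : ℂ) := by
  have hre : l = (l.re : ℂ) :=
    Complex.ext rfl (by rw [Complex.ofReal_im]; exact im_eq_zero_of_mem_pointSpectrum hl)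
  obtain ⟨f, hf, hf0⟩ := Module.End.HasEigenvalue.exists_hasEigenvector hl
  have hrec : EigenRec α a l (coeff f) := (mem_eigenspace_iff hα a l f).1 hf
  rw [hre] at hrec ⊢
  -- The dichotomy: both roots of the leading polynomial on the unit circle, or exactly one inside
  -- the disc.
  rcases le_or_gt |‖a‖ ^ 2 - l.re + 1| (2 * ‖a‖) with h | h
  · have h0 := coeff_zero_eq_zero_of_abs_le hα₀ hα ha h f hrec
    refine absurd (H2.eq_of_coeff fun n => ?_) hf0
    have h1 := hrec.eq_smul (k := 0) ha hrec (by rw [h0, zero_mul]) n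
    rw [h1, zero_mul]
    exact (congrFun coeff_zero.2 n).symm
  · have hfn : f.fn ≠ 0 := fun h1 => hf0 (H2.ext' fun z => congrFun h1 z)
    obtain ⟨j, t, hT, hlt, hlam⟩ := exists_tauEq_of_eigenRec ha h f.holo hfn hrec
    rcases hT.eq_tau hα with rfl | rfl
    · exact ⟨j, 1, Or.inl rfl, hlt, by rw [hlam, eigval_eq hα ha (by norm_num)]⟩
    · exact ⟨j, -1, Or.inr rfl, hlt, by rw [hlam, eigval_eq hα ha (by norm_num)]⟩

theorem eigfun_one_spans {α : ℝ} (hα₀ : 0 < α) (hα : α < 1) {a : ℂ} (ha : a ≠ 0) (j : ℕ) :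
    EigenspaceSpannedBy (V (binomWeight α hα) a) (eigval α a 1 j : ℂ) (eigfun α a 1 j) :=
  eigfun_spans hα ha (by norm_num) j <| (tauEq_tau hα a (by norm_num) j).abs_lt hα₀ hα
    (norm_pos_iff.2 ha) (Or.inl (tau_one_pos hα ha j))

theorem eigfun_neg_one_spans {α : ℝ} (hα₀ : 0 < α) (hα : α < 1) {a : ℂ} (ha : 1 < ‖a‖) (j : ℕ) :
    EigenspaceSpannedBy (V (binomWeight α hα) a) (eigval α a (-1) j : ℂ) (eigfun α a (-1) j) :=
  have hpos : 0 < ‖a‖ := one_pos.trans ha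
  eigfun_spans hα (norm_pos_iff.1 hpos) (by norm_num) j <|
    (tauEq_tau hα a (by norm_num) j).abs_lt hα₀ hα hpos (Or.inr ha)


end WeightedHardy

theorem theorem5p3 (a : ℂ) (ha : a ≠ 0) (α : ℝ) (hα₀ : 0 < α) (hα₁ : α < 1) :
    (‖a‖ ≤ 1 →
      WeightedHardy.pointSpectrum (WeightedHardy.V (WeightedHardy.binomWeight α hα₁) a)
          = {l : ℂ | ∃ j : ℕ, l = (WeightedHardy.eigval α a 1 j : ℂ)} ∧
      ∀ j : ℕ, WeightedHardy.EigenspaceSpannedBy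
        (WeightedHardy.V (WeightedHardy.binomWeight α hα₁) a)
        (WeightedHardy.eigval α a 1 j : ℂ) (WeightedHardy.eigfun α a 1 j)) ∧
    (1 < ‖a‖ →
      WeightedHardy.pointSpectrum (WeightedHardy.V (WeightedHardy.binomWeight α hα₁) a)
          = {l : ℂ | ∃ j : ℕ, l = (WeightedHardy.eigval α a 1 j : ℂ)} ∪
            {l : ℂ | ∃ j : ℕ, l = (WeightedHardy.eigval α a (-1) j : ℂ)} ∧
      ∀ j : ℕ,
        WeightedHardy.EigenspaceSpannedBy
          (WeightedHardy.V (WeightedHardy.binomWeight α hα₁) a)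
          (WeightedHardy.eigval α a 1 j : ℂ) (WeightedHardy.eigfun α a 1 j) ∧
        WeightedHardy.EigenspaceSpannedBy
          (WeightedHardy.V (WeightedHardy.binomWeight α hα₁) a)
          (WeightedHardy.eigval α a (-1) j : ℂ) (WeightedHardy.eigfun α a (-1) j)) := by
  refine ⟨fun h => ⟨?_, fun j => WeightedHardy.eigfun_one_spans hα₀ hα₁ ha j⟩,
    fun h => ⟨?_, fun j => ⟨WeightedHardy.eigfun_one_spans hα₀ hα₁ ha j,
      WeightedHardy.eigfun_neg_one_spans hα₀ hα₁ h j⟩⟩⟩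
  · ext l
    constructor
    · intro hl
      obtain ⟨j, ε, rfl | rfl, hlt, hlj⟩ :=
        WeightedHardy.exists_eigval_of_mem_pointSpectrum hα₀ hα₁ ha hl
      · exact ⟨j, hlj⟩
      -- For `|a| ≤ 1`, an admissible `τ` must be positive, whereas `τ_j^-` is negative.
      · have h1 := (WeightedHardy.tauEq_tau hα₁ a (by norm_num) j).pos hα₀ hα₁ h hlt
        exact absurd h1 (WeightedHardy.tau_neg_one_neg hα₀ hα₁ ha j).not_gt
    · rintro ⟨j, rfl⟩
      exact (WeightedHardy.eigfun_one_spans hα₀ hα₁ ha j).mem_pointSpectrum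
  · ext l
    constructor
    · intro hl
      obtain ⟨j, ε, rfl | rfl, -, hlj⟩ :=
        WeightedHardy.exists_eigval_of_mem_pointSpectrum hα₀ hα₁ ha hl
      · exact Or.inl ⟨j, hlj⟩
      · exact Or.inr ⟨j, hlj⟩
    · rintro (⟨j, rfl⟩ | ⟨j, rfl⟩)
      · exact (WeightedHardy.eigfun_one_spans hα₀ hα₁ ha j).mem_pointSpectrum
      · exact (WeightedHardy.eigfun_neg_one_spans hα₀ hα₁ h j).mem_pointSpectrum
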